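/- Let $1\le n<m$ be integers and let $0<\epsilon<\tfrac12$. Define $$\delta^{\mathrm{Best}}(m,n,\epsilon)=\inf_{\mathcal A}\ \sup_{x\in\mathbb R^m}\ \mathbb P_{A\sim\mathcal A}\Big[\,\big|\|Ax\|_2^2-\|x\|_2^2\big|>\epsilon\|x\|_2^2\Big],$$ where the infimum runs over all (Borel) probability distributions $\mathcal A$ on the space $\mathbb R^{n\times m}$ of real $n\times m$ matrices, and $\|\cdot\|_2$ is the Euclidean norm. Let $B$ be a random variable following the Beta distribution with shape parameters $\frac n2$ and $\frac{m-n}2$. Then $$\min\Big\{\mathbb P\big[B>(1+\epsilon)\,\mathbb E[B]\big],\ \mathbb P\big[B<(1-\epsilon)\,\mathbb E[B]\big]\Big\}\ \le\ \delta^{\mathrm{Best}}(m,n,\epsilon)$$ and $$\delta^{\mathrm{Best}}(m,n,\epsilon)\ \le\ \mathbb P\big[B>(1+\epsilon)\,\mathbb E[B]\big]+\mathbb P\big[B<(1-\epsilon)\,\mathbb E[B]\big].$$ -/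

import Mathlib

open MeasureTheory ProbabilityTheory
open scoped ENNReal

/-- The entrywise product sigma-algebra on real matrices. -/
instance matrixMeasurableSpace (n m : ℕ) : MeasurableSpace (Matrix (Fin n) (Fin m) ℝ) :=
  inferInstanceAs (MeasurableSpace (Fin n → Fin m → ℝ))

/-- The sigma-algebra on real matrices is the Borel sigma-algebra. -/
instance matrixBorelSpace (n m : ℕ) : BorelSpace (Matrix (Fin n) (Fin m) ℝ) :=
  inferInstanceAs (BorelSpace (Fin n → Fin m → ℝ))

/-- The distortion event for the input `x`: the set of `n × m` matrices `A` with
`|‖A x‖₂² - ‖x‖₂²| > ε ‖x‖₂²` (Euclidean norms). -/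
def distortionEvent (m n : ℕ) (ε : ℝ) (x : EuclideanSpace ℝ (Fin m)) :
    Set (Matrix (Fin n) (Fin m) ℝ) :=
  {A | |‖Matrix.toEuclideanLin A x‖ ^ 2 - ‖x‖ ^ 2| > ε * ‖x‖ ^ 2}

theorem measurableSet_distortionEvent (m n : ℕ) (ε : ℝ) (x : EuclideanSpace ℝ (Fin m)) :
    MeasurableSet (distortionEvent m n ε x) := by
  have h : Continuous fun A : Matrix (Fin n) (Fin m) ℝ => ‖Matrix.toEuclideanLin A x‖ :=
    (LinearMap.continuous_of_finiteDimensional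
      ((LinearMap.applyₗ x).comp (Matrix.toEuclideanLin (𝕜 := ℝ) (m := Fin n)
        (n := Fin m)).toLinearMap)).norm
  exact (isOpen_lt continuous_const (((h.pow 2).sub continuous_const).abs)).measurableSet

/-- The optimal distortion probability: the infimum over all probability distributions `P` on real
`n × m` matrices (with the Borel sigma-algebra) of the supremum over all inputs `x` of the
`P`-probability of the distortion event. The value is a probability, taken in `ℝ≥0∞` so that
suprema and infima are unconditional. -/
noncomputable def deltaBest (m n : ℕ) (ε : ℝ) : ℝ≥0∞ :=
  ⨅ P : ProbabilityMeasure (Matrix (Fin n) (Fin m) ℝ),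
    ⨆ x : EuclideanSpace ℝ (Fin m),
      (P : Measure (Matrix (Fin n) (Fin m) ℝ)) (distortionEvent m n ε x)

/-! Both bounds come from one fact. Let x be Gaussian in `ℝ^m`, split orthogonally as y + z with y
in a subspace of dimension n. Then ‖y‖²/‖x‖² has law Beta(n/2, (m-n)/2), independently of the
direction u of y (`lintegral_gaussWeight_comp_ratio_sq`).

Lower bound: a supremum over x dominates the Gaussian average over x, so by Tonelli it is enough to
treat one matrix A. Its kernel contains a subspace K of dimension m - n. With y in the orthogonal
complement of K, ‖Ax‖²/‖x‖² = ‖Au‖² B, where B is the Beta ratio. If ‖Au‖² ≥ 1/t, the upper tail B >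
(1+ε)t forces distortion; otherwise the lower tail B < (1-ε)t does. Either way, conditionally on u,
the probability is at least the smaller tail.

Upper bound: compose t^(-1/2) times an orthogonal projection onto `ℝ^n` with a Haar-random rotation.
Every nonzero x then has the same distortion probability, which is therefore the Gaussian average
for the unrotated matrix. That matrix distorts x exactly when B lies in one of the two tails, and a
union bound finishes.

Both arguments work for every t > 0; the theorem takes t = n/m, the mean of B. -/

/-! ### Gaussian weight: isometries, products, polar coordinates. -/

section Gaussian

variable (E F : Type*) [NormedAddCommGroup E] [InnerProductSpace ℝ E] [FiniteDimensional ℝ E]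
  [MeasurableSpace E] [BorelSpace E]
  [NormedAddCommGroup F] [InnerProductSpace ℝ F] [FiniteDimensional ℝ F]
  [MeasurableSpace F] [BorelSpace F]

/-- The unnormalised Gaussian measure with density `exp (-‖x‖²)`. -/
noncomputable def gaussWeight : Measure E :=
  volume.withDensity fun x => ENNReal.ofReal (Real.exp (-‖x‖ ^ 2))

instance isFiniteMeasure_gaussWeight : IsFiniteMeasure (gaussWeight E) := by
  refine isFiniteMeasure_withDensity_ofReal ?_
  have h := (GaussianFourier.integrable_cexp_neg_mul_sq_norm_add (V := E) (b := 1)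
    (by simp) 0 0).norm
  refine Integrable.hasFiniteIntegral (h.congr (.of_forall fun x => ?_))
  simp only [Complex.norm_exp]
  congr 1
  norm_cast
  simp

variable {E F}

theorem gaussWeight_univ_ne_zero : gaussWeight E Set.univ ≠ 0 := by
  rw [gaussWeight, Measure.measure_univ_ne_zero]
  intro h
  rw [withDensity_eq_zero_iff (by fun_prop)] at h
  have : ∀ᵐ x ∂(volume : Measure E), False := by
    filter_upwards [h] with x hx
    exact (Real.exp_pos (-‖x‖ ^ 2)).not_ge (ENNReal.ofReal_eq_zero.1 hx)
  rw [Filter.eventually_false_iff_eq_bot, ae_eq_bot] at this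
  exact (NeZero.ne (volume : Measure E)) this

theorem gaussWeight_singleton [Nontrivial E] (x : E) : gaussWeight E {x} = 0 :=
  withDensity_absolutelyContinuous _ _ (measure_singleton x)

theorem LinearIsometryEquiv.measurePreserving_gaussWeight (φ : E ≃ₗᵢ[ℝ] F) :
    MeasurePreserving φ (gaussWeight E) (gaussWeight F) := by
  refine ⟨φ.continuous.measurable, ?_⟩
  ext s hs
  rw [Measure.map_apply φ.continuous.measurable hs, gaussWeight, gaussWeight,
    withDensity_apply _ hs, withDensity_apply _ (φ.continuous.measurable hs),
    ← φ.measurePreserving.setLIntegral_comp_preimage hs (by fun_prop)]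
  simp

/-- By Pythagoras, `exp (-‖x‖²)` factors over an orthogonal sum. This independence of the two
components is why a Gaussian replaces the uniform measure on the sphere. -/
theorem measurePreserving_toLp_gaussWeight :
    MeasurePreserving (WithLp.toLp 2 : E × F → WithLp 2 (E × F))
      ((gaussWeight E).prod (gaussWeight F)) (gaussWeight (WithLp 2 (E × F))) := by
  refine ⟨WithLp.measurable_toLp _ _, ?_⟩
  ext s hs
  rw [Measure.map_apply (WithLp.measurable_toLp _ _) hs, gaussWeight, gaussWeight, gaussWeight,
    prod_withDensity (by fun_prop) (by fun_prop), withDensity_apply _ hs,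
    withDensity_apply _ (WithLp.measurable_toLp _ _ hs),
    ← (WithLp.volume_preserving_toLp E F).setLIntegral_comp_preimage hs (by fun_prop)]
  refine lintegral_congr fun x => ?_
  rw [← ENNReal.ofReal_mul (Real.exp_pos _).le, ← Real.exp_add, WithLp.prod_norm_sq_eq_of_L2]
  simp [add_comm]

theorem lintegral_eq_lintegral_toSphere [Nontrivial E] {f : E → ℝ≥0∞} (hf : Measurable f) :
    ∫⁻ x, f x = ∫⁻ u : Metric.sphere (0 : E) 1, (∫⁻ r in Set.Ioi (0 : ℝ),
      ENNReal.ofReal (r ^ (Module.finrank ℝ E - 1)) * f (r • (u : E)))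
        ∂(volume : Measure E).toSphere := by
  have h1 : ∫⁻ x, f x = ∫⁻ x : ({0}ᶜ : Set E), f x ∂((volume : Measure E).comap (↑)) := by
    rw [lintegral_subtype_comap (measurableSet_singleton _).compl f, restrict_compl_singleton]
  have h2 := ((volume : Measure E).measurePreserving_homeomorphUnitSphereProd).lintegral_comp
    (f := fun p => f ((homeomorphUnitSphereProd E).symm p).1)
    (hf.comp (measurable_subtype_coe.comp (homeomorphUnitSphereProd E).symm.continuous.measurable))
  simp only [Homeomorph.symm_apply_apply] at h2
  have hm : Measurable fun p : Metric.sphere (0 : E) 1 × Set.Ioi (0 : ℝ) =>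
      f ((homeomorphUnitSphereProd E).symm p).1 :=
    hf.comp (measurable_subtype_coe.comp (homeomorphUnitSphereProd E).symm.continuous.measurable)
  rw [h1, h2, lintegral_prod _ hm.aemeasurable]
  refine lintegral_congr fun u => ?_
  rw [Measure.volumeIoiPow, lintegral_withDensity_eq_lintegral_mul _ (by fun_prop)
    (by exact hm.comp measurable_prodMk_left),
    ← lintegral_subtype_comap measurableSet_Ioi]
  refine lintegral_congr fun r => ?_
  simp

theorem lintegral_gaussWeight [Nontrivial E] {f : E → ℝ≥0∞} (hf : Measurable f) :
    ∫⁻ x, f x ∂(gaussWeight E) = ∫⁻ u : Metric.sphere (0 : E) 1, (∫⁻ r in Set.Ioi (0 : ℝ),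
      ENNReal.ofReal (r ^ (Module.finrank ℝ E - 1) * Real.exp (-r ^ 2)) * f (r • (u : E)))
        ∂(volume : Measure E).toSphere := by
  rw [gaussWeight, lintegral_withDensity_eq_lintegral_mul _ (by fun_prop) hf,
    lintegral_eq_lintegral_toSphere (by fun_prop)]
  refine lintegral_congr fun u => setLIntegral_congr_fun measurableSet_Ioi fun r (hr : 0 < r) => ?_
  simp only [Pi.mul_apply, norm_smul, norm_eq_of_mem_sphere, mul_one, Real.norm_eq_abs, sq_abs]
  rw [ENNReal.ofReal_mul (by positivity), mul_assoc]

end Gaussian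

/-! ### Beta distribution: its mean, and its origin as a ratio of squared radii. -/

section Beta

theorem measurable_betaPDF (p q : ℝ) : Measurable (betaPDF p q) :=
  (measurable_betaPDFReal p q).ennreal_ofReal

theorem integral_id_betaMeasure {p q : ℝ} (hp : 0 < p) (hq : 0 < q) :
    ∫ x, x ∂(betaMeasure p q) = p / (p + q) := by
  have hpos : ∀ᵐ x ∂(betaMeasure p q), 0 ≤ x := by
    rw [betaMeasure, ae_withDensity_iff (measurable_betaPDF p q)]
    refine .of_forall fun x hx => ?_
    by_contra h
    exact hx (betaPDF_eq_zero_of_nonpos (not_le.1 h).le)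
  rw [integral_eq_lintegral_of_nonneg_ae hpos (by fun_prop), betaMeasure,
    lintegral_withDensity_eq_lintegral_mul _ (measurable_betaPDF p q)
      (by fun_prop)]
  -- Multiplying the Beta(p, q) density by x gives p/(p+q) times the Beta(p+1, q) density, whose
  -- total mass is one.
  have key : ∀ x, (betaPDF p q * fun x => ENNReal.ofReal x) x =
      ENNReal.ofReal (p / (p + q)) * betaPDF (p + 1) q x := by
    intro x
    by_cases hx : 0 < x ∧ x < 1
    · rw [Pi.mul_apply, betaPDF_of_pos_lt_one hx.1 hx.2, betaPDF_of_pos_lt_one hx.1 hx.2,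
        ← ENNReal.ofReal_mul' hx.1.le, ← ENNReal.ofReal_mul (by positivity)]
      congr 1
      have h1 : x ^ (p + 1 - 1) = x ^ (p - 1) * x := by
        rw [← Real.rpow_add_one hx.1.ne']; ring_nf
      have h2 : p + 1 + q = (p + q) + 1 := by ring
      have h3 := (Real.Gamma_pos_of_pos hp).ne'
      have h4 := (Real.Gamma_pos_of_pos hq).ne'
      have h5 := (Real.Gamma_pos_of_pos (add_pos hp hq)).ne'
      rw [h1, beta, beta, h2, Real.Gamma_add_one hp.ne', Real.Gamma_add_one (by positivity)]
      field_simp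
    · have h0 : ∀ a, betaPDF a q x = 0 := fun a => by simp [betaPDF_eq, hx]
      simp [h0]
  simp_rw [key]
  rw [lintegral_const_mul _ (measurable_betaPDF _ q),
    lintegral_betaPDF_eq_one (by positivity) hq, mul_one, ENNReal.toReal_ofReal (by positivity)]

theorem lintegral_Ioi_comp_mul_left {c : ℝ} (hc : 0 < c) (f : ℝ → ℝ≥0∞) :
    ∫⁻ x in Set.Ioi (0 : ℝ), f x = ∫⁻ x in Set.Ioi (0 : ℝ), ENNReal.ofReal c * f (c * x) := by
  have h := lintegral_image_eq_lintegral_abs_deriv_mul (s := Set.Ioi (0 : ℝ)) (f := fun x => c * x)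
    (f' := fun _ => c) measurableSet_Ioi
    (fun x _ => by simpa using ((hasDerivAt_id x).const_mul c).hasDerivWithinAt)
    (fun x _ y _ h => mul_left_cancel₀ hc.ne' h) f
  rw [Set.image_mul_left_Ioi hc, mul_zero, abs_of_pos hc] at h
  exact h

theorem lintegral_Ioi_comp_inv_one_add_sq (f : ℝ → ℝ≥0∞) :
    ∫⁻ c in Set.Ioi (0 : ℝ), f c = ∫⁻ v in Set.Ioo (0 : ℝ) 1,
      ENNReal.ofReal (v⁻¹ ^ 2 / (2 * √(v⁻¹ - 1))) * f (√(v⁻¹ - 1)) := by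
  have hpos : ∀ v ∈ Set.Ioo (0 : ℝ) 1, 0 < v⁻¹ - 1 := fun v hv => by
    have := (one_lt_inv₀ hv.1).2 hv.2
    linarith
  have h := lintegral_image_eq_lintegral_abs_deriv_mul (s := Set.Ioo (0 : ℝ) 1)
    (f := fun v => √(v⁻¹ - 1)) (f' := fun v => -(v ^ 2)⁻¹ / (2 * √(v⁻¹ - 1))) measurableSet_Ioo
    (fun v hv => ((((hasDerivAt_inv hv.1.ne').sub_const 1).sqrt (hpos v hv).ne')).hasDerivWithinAt)
    (fun v hv w hw h => by
      have := (Real.sqrt_inj (hpos v hv).le (hpos w hw).le).1 h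
      exact inv_injective (by linarith)) f
  have himg : (fun v : ℝ => √(v⁻¹ - 1)) '' Set.Ioo 0 1 = Set.Ioi 0 := by
    ext c
    constructor
    · rintro ⟨v, hv, rfl⟩
      exact Real.sqrt_pos.2 (hpos v hv)
    · intro (hc : 0 < c)
      refine ⟨(1 + c ^ 2)⁻¹, ⟨by positivity, inv_lt_one_of_one_lt₀ (by nlinarith)⟩, ?_⟩
      simp [Real.sqrt_sq hc.le]
  rw [himg] at h
  rw [h]
  refine setLIntegral_congr_fun measurableSet_Ioo fun v hv => ?_
  rw [neg_div, abs_neg, abs_of_nonneg (by positivity), inv_pow]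

/-- The substitution s = rc turns the ratio into 1/(1+c²), free of r. Rescaling r by (1+c²)^(-1/2)
then splits off a radial constant, and v = 1/(1+c²) turns the remaining weight in c into the Beta
density up to a factor. The value of C is irrelevant later, since both sides of each comparison
carry it. -/
theorem lintegral_lintegral_comp_ratio_sq {n k : ℕ} (hn : 1 ≤ n) (hk : 1 ≤ k) :
    ∃ C : ℝ≥0∞, ∀ g : ℝ → ℝ≥0∞, Measurable g →
      ∫⁻ r in Set.Ioi (0 : ℝ), ENNReal.ofReal (r ^ (n - 1) * Real.exp (-r ^ 2)) *
        ∫⁻ s in Set.Ioi (0 : ℝ), ENNReal.ofReal (s ^ (k - 1) * Real.exp (-s ^ 2)) *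
          g (r ^ 2 / (r ^ 2 + s ^ 2)) = C * ∫⁻ v, g v ∂(betaMeasure (n / 2) (k / 2)) := by
  have hb : (0 : ℝ) < beta ((n : ℝ) / 2) ((k : ℝ) / 2) :=
    beta_pos (by positivity) (by positivity)
  refine ⟨(∫⁻ r in Set.Ioi (0 : ℝ), ENNReal.ofReal (r ^ (n + k - 1) * Real.exp (-r ^ 2))) *
    ENNReal.ofReal (beta ((n : ℝ) / 2) ((k : ℝ) / 2) / 2), fun g hg => ?_⟩
  have h1 : ∀ r ∈ Set.Ioi (0 : ℝ), ENNReal.ofReal (r ^ (n - 1) * Real.exp (-r ^ 2)) *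
        ∫⁻ s in Set.Ioi (0 : ℝ), ENNReal.ofReal (s ^ (k - 1) * Real.exp (-s ^ 2)) *
          g (r ^ 2 / (r ^ 2 + s ^ 2)) =
      ∫⁻ c in Set.Ioi (0 : ℝ), ENNReal.ofReal (r ^ (n + k - 1) * Real.exp (-(r ^ 2 * (1 + c ^ 2))) *
        c ^ (k - 1)) * g (1 + c ^ 2)⁻¹ := by
    intro r (hr : 0 < r)
    rw [lintegral_Ioi_comp_mul_left hr, ← lintegral_const_mul _ (by fun_prop)]
    refine setLIntegral_congr_fun measurableSet_Ioi fun c (hc : 0 < c) => ?_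
    rw [← mul_assoc, ← mul_assoc, ← ENNReal.ofReal_mul (by positivity),
      ← ENNReal.ofReal_mul (by positivity)]
    have e1 : r ^ 2 / (r ^ 2 + (r * c) ^ 2) = (1 + c ^ 2)⁻¹ := by field_simp
    have e2 : r ^ (n + k - 1) = r ^ (n - 1) * r * r ^ (k - 1) := by
      rw [← pow_succ, ← pow_add]; congr 1; omega
    have e3 : Real.exp (-(r ^ 2 * (1 + c ^ 2))) = Real.exp (-r ^ 2) * Real.exp (-(r * c) ^ 2) := by
      rw [← Real.exp_add]; ring_nf
    rw [e1, e2, e3, mul_pow]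
    congr 2
    ring
  rw [setLIntegral_congr_fun measurableSet_Ioi h1, lintegral_lintegral_swap (by fun_prop)]
  have h2 : ∀ c ∈ Set.Ioi (0 : ℝ), ∫⁻ r in Set.Ioi (0 : ℝ),
      ENNReal.ofReal (r ^ (n + k - 1) * Real.exp (-(r ^ 2 * (1 + c ^ 2))) *
        c ^ (k - 1)) * g (1 + c ^ 2)⁻¹ =
      (∫⁻ r in Set.Ioi (0 : ℝ), ENNReal.ofReal (r ^ (n + k - 1) * Real.exp (-r ^ 2))) *
        (ENNReal.ofReal (c ^ (k - 1) * (√(1 + c ^ 2))⁻¹ ^ (n + k)) * g (1 + c ^ 2)⁻¹) := by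
    intro c (hc : 0 < c)
    rw [lintegral_Ioi_comp_mul_left (c := (√(1 + c ^ 2))⁻¹) (by positivity),
      ← lintegral_mul_const _ (by fun_prop)]
    refine setLIntegral_congr_fun measurableSet_Ioi fun r (hr : 0 < r) => ?_
    rw [← mul_assoc, ← mul_assoc, ← ENNReal.ofReal_mul (by positivity),
      ← ENNReal.ofReal_mul (by positivity)]
    have e1 : ((√(1 + c ^ 2))⁻¹ * r) ^ 2 * (1 + c ^ 2) = r ^ 2 := by
      rw [mul_pow, inv_pow, Real.sq_sqrt (by positivity)]
      field_simp
    rw [e1, mul_pow]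
    congr 2
    obtain ⟨l, hl⟩ : ∃ l, n + k = l + 1 := ⟨n + k - 1, by omega⟩
    rw [hl, Nat.add_sub_cancel]
    ring
  rw [setLIntegral_congr_fun measurableSet_Ioi h2, lintegral_const_mul _ (by fun_prop), mul_assoc]
  congr 1
  rw [betaMeasure, lintegral_withDensity_eq_lintegral_mul _
    (measurable_betaPDF _ _) hg, ← lintegral_const_mul _
    ((measurable_betaPDF _ _).mul hg), lintegral_Ioi_comp_inv_one_add_sq,
    ← lintegral_indicator measurableSet_Ioo]
  refine lintegral_congr fun v => ?_
  by_cases hv : v ∈ Set.Ioo (0 : ℝ) 1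
  · rw [Set.indicator_of_mem hv, Pi.mul_apply, betaPDF_of_pos_lt_one hv.1 hv.2]
    obtain ⟨h0, h1⟩ := hv
    have h1' : 0 < 1 - v := by linarith
    have e0 : v⁻¹ - 1 = (1 - v) / v := by field_simp
    have e1 : 1 + √(v⁻¹ - 1) ^ 2 = v⁻¹ := by
      rw [Real.sq_sqrt (by rw [e0]; positivity)]; ring
    rw [e1, inv_inv, ← mul_assoc, ← mul_assoc, ← ENNReal.ofReal_mul (by positivity),
      ← ENNReal.ofReal_mul (by positivity)]
    congr 2
    have e2 : (√v⁻¹)⁻¹ ^ (n + k) = v ^ ((n : ℝ) / 2) * v ^ ((k : ℝ) / 2) := by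
      rw [Real.sqrt_inv, inv_inv, Real.sqrt_eq_rpow, ← Real.rpow_natCast, ← Real.rpow_mul h0.le,
        ← Real.rpow_add h0]
      congr 1; push_cast; ring
    have hc : 0 < √(v⁻¹ - 1) := Real.sqrt_pos.2 (by rw [e0]; positivity)
    have e3 : √(v⁻¹ - 1) ^ (k - 1) * √(v⁻¹ - 1) = (1 - v) ^ ((k : ℝ) / 2) / v ^ ((k : ℝ) / 2) := by
      rw [← pow_succ, Nat.sub_add_cancel hk, e0, ← Real.div_rpow h1'.le h0.le, Real.sqrt_eq_rpow,
        ← Real.rpow_natCast, ← Real.rpow_mul (by positivity)]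
      congr 1; ring
    have e4 : √(v⁻¹ - 1) * √(v⁻¹ - 1) = (1 - v) / v := by
      rw [Real.mul_self_sqrt (by rw [e0]; positivity), e0]
    rw [Real.rpow_sub_one h0.ne', Real.rpow_sub_one h1'.ne', e2]
    calc v⁻¹ ^ 2 / (2 * √(v⁻¹ - 1)) * (√(v⁻¹ - 1) ^ (k - 1) *
          (v ^ ((n : ℝ) / 2) * v ^ ((k : ℝ) / 2)))
        = v⁻¹ ^ 2 / 2 * (√(v⁻¹ - 1) ^ (k - 1) * √(v⁻¹ - 1)) / (√(v⁻¹ - 1) * √(v⁻¹ - 1)) *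
          (v ^ ((n : ℝ) / 2) * v ^ ((k : ℝ) / 2)) := by field_simp
      _ = _ := by
        rw [e3, e4]
        have := (Real.rpow_pos_of_pos h0 ((k : ℝ) / 2)).ne'
        field_simp
  · simp [betaPDF_eq, show ¬ (0 < v ∧ v < 1) from hv]

end Beta

/-! ### Distortion on an orthogonal product, one direction at a time. -/

section Product

variable {E F : Type*} [NormedAddCommGroup E] [InnerProductSpace ℝ E] [FiniteDimensional ℝ E]
  [MeasurableSpace E] [BorelSpace E] [Nontrivial E]
  [NormedAddCommGroup F] [InnerProductSpace ℝ F] [FiniteDimensional ℝ F]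
  [MeasurableSpace F] [BorelSpace F] [Nontrivial F]

omit [Nontrivial F] in
theorem lintegral_gaussWeight_prod {f : E × F → ℝ≥0∞} (hf : Measurable f) :
    ∫⁻ p, f p ∂((gaussWeight E).prod (gaussWeight F)) =
      ∫⁻ u : Metric.sphere (0 : E) 1, (∫⁻ r in Set.Ioi (0 : ℝ),
        ENNReal.ofReal (r ^ (Module.finrank ℝ E - 1) * Real.exp (-r ^ 2)) *
          ∫⁻ z, f (r • (u : E), z) ∂(gaussWeight F)) ∂(volume : Measure E).toSphere := by
  rw [lintegral_prod _ hf.aemeasurable, lintegral_gaussWeight hf.lintegral_prod_right']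

variable (F) in
theorem lintegral_gaussWeight_comp_ratio_sq {n : ℕ} (hn : 1 ≤ n) :
    ∃ C : ℝ≥0∞, ∀ g : ℝ → ℝ≥0∞, Measurable g →
      ∫⁻ r in Set.Ioi (0 : ℝ), ENNReal.ofReal (r ^ (n - 1) * Real.exp (-r ^ 2)) *
        ∫⁻ z, g (r ^ 2 / (r ^ 2 + ‖z‖ ^ 2)) ∂(gaussWeight F) =
      C * ∫⁻ v, g v ∂(betaMeasure (n / 2) (Module.finrank ℝ F / 2)) := by
  obtain ⟨C, hC⟩ := lintegral_lintegral_comp_ratio_sq hn (Module.finrank_pos (R := ℝ) (M := F))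
  refine ⟨(volume : Measure F).toSphere Set.univ * C, fun g hg => ?_⟩
  rw [mul_assoc, ← hC g hg, ← lintegral_const_mul']
  · refine setLIntegral_congr_fun measurableSet_Ioi fun r (hr : 0 < r) => ?_
    rw [lintegral_gaussWeight (by fun_prop), mul_left_comm]
    congr 1
    rw [mul_comm, ← lintegral_const]
    refine lintegral_congr fun u => setLIntegral_congr_fun measurableSet_Ioi fun s _ => ?_
    simp [norm_smul]
  · exact measure_ne_top _ _

/-- Along a direction `u`, one of the two one-sided events for `‖y‖² / (‖y‖² + ‖z‖²)` forces the
distortion of `(y, z)`, according to whether `‖L u‖²` is above or below `t⁻¹`. -/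
theorem min_betaMeasure_mul_le_gaussWeight_prod {V : Type*} [NormedAddCommGroup V]
    [NormedSpace ℝ V] (L : E →ₗ[ℝ] V) {t ε : ℝ} (ht : 0 < t) :
    min (betaMeasure (Module.finrank ℝ E / 2) (Module.finrank ℝ F / 2) (Set.Ioi ((1 + ε) * t)))
        (betaMeasure (Module.finrank ℝ E / 2) (Module.finrank ℝ F / 2) (Set.Iio ((1 - ε) * t))) *
      ((gaussWeight E).prod (gaussWeight F)) Set.univ ≤
    ((gaussWeight E).prod (gaussWeight F))
      {p | ε * (‖p.1‖ ^ 2 + ‖p.2‖ ^ 2) < |‖L p.1‖ ^ 2 - (‖p.1‖ ^ 2 + ‖p.2‖ ^ 2)|} := by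
  set β := betaMeasure ((Module.finrank ℝ E : ℝ) / 2) ((Module.finrank ℝ F : ℝ) / 2) with hβ
  have hE : 0 < Module.finrank ℝ E := Module.finrank_pos
  have hF : 0 < Module.finrank ℝ F := Module.finrank_pos
  have : IsProbabilityMeasure β := isProbabilityMeasureBeta (by positivity) (by positivity)
  obtain ⟨C, hC⟩ := lintegral_gaussWeight_comp_ratio_sq F hE
  have hL : Continuous L := L.continuous_of_finiteDimensional
  have hS : MeasurableSet {p : E × F | ε * (‖p.1‖ ^ 2 + ‖p.2‖ ^ 2) <
      |‖L p.1‖ ^ 2 - (‖p.1‖ ^ 2 + ‖p.2‖ ^ 2)|} :=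
    (isOpen_lt (by fun_prop) (by fun_prop)).measurableSet
  rw [← lintegral_indicator_one hS, ← lintegral_one, lintegral_gaussWeight_prod measurable_const,
    lintegral_gaussWeight_prod (measurable_one.indicator hS), ← lintegral_const_mul']
  · refine lintegral_mono fun u => ?_
    -- Testing with g = 1 identifies C as the radial mass, so C never has to be evaluated.
    have h1 := hC 1 measurable_one
    simp only [Pi.one_apply] at h1
    rw [h1, lintegral_one, measure_univ, mul_one, mul_comm]
    have hu : ∀ r : ℝ, 0 < r → ‖r • (u : E)‖ = r := fun r hr => by
      simp [norm_smul, abs_of_pos hr]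
    rcases le_total t⁻¹ (‖L u‖ ^ 2) with hw | hw
    · refine (mul_le_mul_right (min_le_left _ _) C).trans ?_
      rw [← lintegral_indicator_one measurableSet_Ioi, ← hC _ (measurable_one.indicator
        measurableSet_Ioi)]
      refine setLIntegral_mono' measurableSet_Ioi fun r (hr : 0 < r) =>
        mul_le_mul_right (lintegral_mono fun z => ?_) _
      by_cases hz : r ^ 2 / (r ^ 2 + ‖z‖ ^ 2) ∈ Set.Ioi ((1 + ε) * t)
      · rw [Set.indicator_of_mem hz, Set.indicator_of_mem]
        · simp
        · simp only [Set.mem_ofPred_eq, map_smul, norm_smul, mul_pow, Real.norm_eq_abs, sq_abs,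
            norm_eq_of_mem_sphere, mul_one]
          rw [Set.mem_Ioi, lt_div_iff₀ (by positivity)] at hz
          have h2 : 1 ≤ t * ‖L u‖ ^ 2 := by rwa [inv_le_iff_one_le_mul₀' ht] at hw
          refine lt_abs.2 (Or.inl ?_)
          have h3 : t * ((1 + ε) * (r ^ 2 + ‖z‖ ^ 2)) < t * (r ^ 2 * ‖L u‖ ^ 2) := by
            nlinarith [mul_le_mul_of_nonneg_left h2 (sq_nonneg r)]
          linarith [lt_of_mul_lt_mul_left h3 ht.le]
      · simp [Set.indicator_of_notMem hz]
    · refine (mul_le_mul_right (min_le_right _ _) C).trans ?_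
      rw [← lintegral_indicator_one measurableSet_Iio, ← hC _ (measurable_one.indicator
        measurableSet_Iio)]
      refine setLIntegral_mono' measurableSet_Ioi fun r (hr : 0 < r) =>
        mul_le_mul_right (lintegral_mono fun z => ?_) _
      by_cases hz : r ^ 2 / (r ^ 2 + ‖z‖ ^ 2) ∈ Set.Iio ((1 - ε) * t)
      · rw [Set.indicator_of_mem hz, Set.indicator_of_mem]
        · simp
        · simp only [Set.mem_ofPred_eq, map_smul, norm_smul, mul_pow, Real.norm_eq_abs, sq_abs,
            norm_eq_of_mem_sphere, mul_one]
          rw [Set.mem_Iio, div_lt_iff₀ (by positivity)] at hz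
          have h2 : t * ‖L u‖ ^ 2 ≤ 1 := by
            rwa [← one_div, le_div_iff₀' ht] at hw
          refine lt_abs.2 (Or.inr ?_)
          have h3 : t * (r ^ 2 * ‖L u‖ ^ 2) < t * ((1 - ε) * (r ^ 2 + ‖z‖ ^ 2)) := by
            nlinarith [mul_le_mul_of_nonneg_left h2 (sq_nonneg r)]
          linarith [lt_of_mul_lt_mul_left h3 ht.le]
      · simp [Set.indicator_of_notMem hz]
  · exact ((min_le_left _ _).trans_lt (measure_lt_top _ _)).ne

/-- Here the squared image norm is t⁻¹‖y‖², with no dependence on the direction of y, so distortion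
means exactly that the ratio leaves the interval from (1-ε)t to (1+ε)t. -/
theorem gaussWeight_prod_le_betaMeasure_mul {t ε : ℝ} (ht : 0 < t) :
    ((gaussWeight E).prod (gaussWeight F))
      {p | ε * (‖p.1‖ ^ 2 + ‖p.2‖ ^ 2) < |t⁻¹ * ‖p.1‖ ^ 2 - (‖p.1‖ ^ 2 + ‖p.2‖ ^ 2)|} ≤
    (betaMeasure (Module.finrank ℝ E / 2) (Module.finrank ℝ F / 2) (Set.Ioi ((1 + ε) * t)) +
      betaMeasure (Module.finrank ℝ E / 2) (Module.finrank ℝ F / 2) (Set.Iio ((1 - ε) * t))) *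
      ((gaussWeight E).prod (gaussWeight F)) Set.univ := by
  set β := betaMeasure ((Module.finrank ℝ E : ℝ) / 2) ((Module.finrank ℝ F : ℝ) / 2) with hβ
  have hE : 0 < Module.finrank ℝ E := Module.finrank_pos
  have hF : 0 < Module.finrank ℝ F := Module.finrank_pos
  have : IsProbabilityMeasure β := isProbabilityMeasureBeta (by positivity) (by positivity)
  obtain ⟨C, hC⟩ := lintegral_gaussWeight_comp_ratio_sq F hE
  have hS : MeasurableSet {p : E × F | ε * (‖p.1‖ ^ 2 + ‖p.2‖ ^ 2) <
      |t⁻¹ * ‖p.1‖ ^ 2 - (‖p.1‖ ^ 2 + ‖p.2‖ ^ 2)|} :=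
    (isOpen_lt (by fun_prop) (by fun_prop)).measurableSet
  have hT : MeasurableSet (Set.Ioi ((1 + ε) * t) ∪ Set.Iio ((1 - ε) * t)) :=
    measurableSet_Ioi.union measurableSet_Iio
  grw [← measure_union_le]
  rw [← lintegral_indicator_one hS, ← lintegral_one, lintegral_gaussWeight_prod measurable_const,
    lintegral_gaussWeight_prod (measurable_one.indicator hS),
    ← lintegral_const_mul' _ _ (measure_ne_top _ _)]
  refine lintegral_mono fun u => ?_
  have h1 := hC 1 measurable_one
  simp only [Pi.one_apply] at h1
  rw [h1, lintegral_one, measure_univ, mul_one, mul_comm, ← lintegral_indicator_one hT,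
    ← hC _ (measurable_one.indicator hT)]
  refine setLIntegral_mono' measurableSet_Ioi fun r (hr : 0 < r) =>
    mul_le_mul_right (lintegral_mono fun z => ?_) _
  by_cases hz : (r • (u : E), z) ∈ {p : E × F | ε * (‖p.1‖ ^ 2 + ‖p.2‖ ^ 2) <
      |t⁻¹ * ‖p.1‖ ^ 2 - (‖p.1‖ ^ 2 + ‖p.2‖ ^ 2)|}
  · rw [Set.indicator_of_mem hz, Set.indicator_of_mem]
    · simp
    · simp only [Set.mem_ofPred_eq, norm_smul, Real.norm_eq_abs, abs_of_pos hr,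
        norm_eq_of_mem_sphere, mul_one] at hz
      have h2 : t * (t⁻¹ * r ^ 2) = r ^ 2 := by field_simp
      rw [Set.mem_union, Set.mem_Ioi, Set.mem_Iio, lt_div_iff₀ (by positivity),
        div_lt_iff₀ (by positivity)]
      rcases lt_abs.1 hz with h | h
      · left
        have := mul_lt_mul_of_pos_left h ht
        linarith
      · right
        have := mul_lt_mul_of_pos_left h ht
        linarith
  · simp [Set.indicator_of_notMem hz]

end Product

/-! ### Lower bound: splitting along the kernel and averaging over inputs. -/

/-- By rank-nullity the kernel has dimension at least m - n. A subspace K of exactly that dimension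
is chosen inside it, so that the Beta parameters do not depend on the rank of A. -/
theorem exists_linearIsometryEquiv_apply_snd_eq_zero {m n : ℕ} (hnm : n ≤ m)
    {V : Type*} [AddCommGroup V] [Module ℝ V] [FiniteDimensional ℝ V]
    (hV : Module.finrank ℝ V = n) (A : EuclideanSpace ℝ (Fin m) →ₗ[ℝ] V) :
    ∃ φ : WithLp 2 (EuclideanSpace ℝ (Fin n) × EuclideanSpace ℝ (Fin (m - n))) ≃ₗᵢ[ℝ]
      EuclideanSpace ℝ (Fin m), ∀ z, A (φ (WithLp.toLp 2 (0, z))) = 0 := by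
  have hker : m - n ≤ Module.finrank ℝ A.ker := by
    have h1 := A.finrank_range_add_finrank_ker
    have h2 := Submodule.finrank_le A.range
    rw [finrank_euclideanSpace_fin] at h1
    omega
  obtain ⟨f, hf⟩ := exists_linearIndependent_of_le_finrank hker
  have hf' : LinearIndependent ℝ (fun i => (f i : EuclideanSpace ℝ (Fin m))) :=
    hf.map' A.ker.subtype A.ker.ker_subtype
  set K := Submodule.span ℝ (Set.range fun i => (f i : EuclideanSpace ℝ (Fin m))) with hK
  have hKd : Module.finrank ℝ K = m - n := by rw [finrank_span_eq_card hf', Fintype.card_fin]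
  have hKA : K ≤ A.ker := Submodule.span_le.2 (by rintro _ ⟨i, rfl⟩; exact (f i).2)
  have hKo : Module.finrank ℝ Kᗮ = n := by
    have := K.finrank_add_finrank_orthogonal
    rw [finrank_euclideanSpace_fin] at this
    omega
  let e₁ : EuclideanSpace ℝ (Fin n) ≃ₗᵢ[ℝ] Kᗮ :=
    ((stdOrthonormalBasis ℝ Kᗮ).reindex (finCongr hKo)).repr.symm
  let e₂ : EuclideanSpace ℝ (Fin (m - n)) ≃ₗᵢ[ℝ] Kᗮᗮ :=
    ((stdOrthonormalBasis ℝ Kᗮᗮ).reindex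
      (finCongr (by rw [K.orthogonal_orthogonal, hKd]))).repr.symm
  refine ⟨(LinearIsometryEquiv.withLpProdCongr 2 e₁ e₂).trans Kᗮ.orthogonalDecomposition.symm,
    fun z => ?_⟩
  have h : ((e₂ z : Kᗮᗮ) : EuclideanSpace ℝ (Fin m)) ∈ K :=
    K.orthogonal_orthogonal.le (e₂ z).2
  have h' : A (e₂ z : EuclideanSpace ℝ (Fin m)) = 0 := hKA h
  simpa using h'

theorem finrank_div_two_cast_sub {m n : ℕ} (hnm : n ≤ m) :
    ((Module.finrank ℝ (EuclideanSpace ℝ (Fin (m - n))) : ℕ) : ℝ) / 2 = ((m : ℝ) - n) / 2 := by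
  rw [finrank_euclideanSpace_fin, Nat.cast_sub hnm]

theorem continuous_toEuclideanLin_apply (m n : ℕ) :
    Continuous fun p : Matrix (Fin n) (Fin m) ℝ × EuclideanSpace ℝ (Fin m) =>
      Matrix.toEuclideanLin p.1 p.2 := by
  have : Continuous fun p : Matrix (Fin n) (Fin m) ℝ × EuclideanSpace ℝ (Fin m) =>
      WithLp.toLp 2 (p.1.mulVec p.2.ofLp) := by fun_prop
  exact this

theorem measurableSet_prod_distortionEvent (m n : ℕ) (ε : ℝ) :
    MeasurableSet {p : Matrix (Fin n) (Fin m) ℝ × EuclideanSpace ℝ (Fin m) |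
      p.1 ∈ distortionEvent m n ε p.2} := by
  have : SecondCountableTopology (Matrix (Fin n) (Fin m) ℝ) :=
    inferInstanceAs (SecondCountableTopology (Fin n → Fin m → ℝ))
  have := continuous_toEuclideanLin_apply m n
  exact (isOpen_lt (continuous_const.mul (continuous_snd.norm.pow 2))
    (((this.norm.pow 2).sub (continuous_snd.norm.pow 2)).abs)).measurableSet

theorem measurableSet_distortion_input {m n : ℕ} (ε : ℝ) (A : Matrix (Fin n) (Fin m) ℝ) :
    MeasurableSet {x | A ∈ distortionEvent m n ε x} :=
  measurable_prodMk_left (measurableSet_prod_distortionEvent m n ε)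

theorem min_betaMeasure_mul_le_gaussWeight_distortion {m n : ℕ} (hn : 1 ≤ n) (hnm : n < m)
    {t ε : ℝ} (ht : 0 < t) (A : Matrix (Fin n) (Fin m) ℝ) :
    min (betaMeasure (n / 2) ((m - n) / 2) (Set.Ioi ((1 + ε) * t)))
        (betaMeasure (n / 2) ((m - n) / 2) (Set.Iio ((1 - ε) * t))) *
      gaussWeight (EuclideanSpace ℝ (Fin m)) Set.univ ≤
    gaussWeight (EuclideanSpace ℝ (Fin m)) {x | A ∈ distortionEvent m n ε x} := by
  have : NeZero n := ⟨by omega⟩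
  have : NeZero (m - n) := ⟨by omega⟩
  obtain ⟨φ, hφ⟩ := exists_linearIsometryEquiv_apply_snd_eq_zero hnm.le
    (finrank_euclideanSpace_fin (𝕜 := ℝ) (n := n)) (Matrix.toEuclideanLin A)
  have hψ := φ.measurePreserving_gaussWeight.comp measurePreserving_toLp_gaussWeight
  have hS := measurableSet_distortion_input ε A
  rw [← hψ.measure_preimage hS.nullMeasurableSet, ← hψ.measure_preimage
    MeasurableSet.univ.nullMeasurableSet, Set.preimage_univ]
  have key := min_betaMeasure_mul_le_gaussWeight_prod
    (E := EuclideanSpace ℝ (Fin n)) (F := EuclideanSpace ℝ (Fin (m - n))) (ε := ε)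
    ((Matrix.toEuclideanLin A) ∘ₗ φ.toLinearEquiv.toLinearMap ∘ₗ
      (WithLp.linearEquiv 2 ℝ _).symm.toLinearMap ∘ₗ LinearMap.inl ℝ _ _) ht
  rw [finrank_div_two_cast_sub hnm.le, finrank_euclideanSpace_fin] at key
  refine key.trans_eq ?_
  congr 1
  ext p
  have h1 : Matrix.toEuclideanLin A (φ (WithLp.toLp 2 p)) =
      Matrix.toEuclideanLin A (φ (WithLp.toLp 2 (p.1, 0))) := by
    have : WithLp.toLp 2 p = WithLp.toLp 2 (p.1, 0) + WithLp.toLp 2 (0, p.2) := by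
      rw [← WithLp.toLp_add]; simp
    rw [this, map_add, map_add, hφ, add_zero]
  have h2 : ‖φ (WithLp.toLp 2 p)‖ ^ 2 = ‖p.1‖ ^ 2 + ‖p.2‖ ^ 2 := by
    rw [φ.norm_map, WithLp.prod_norm_sq_eq_of_L2]
    rfl
  simp only [distortionEvent, Set.mem_ofPred_eq, Set.mem_preimage, Function.comp_apply, h1, h2,
    gt_iff_lt]
  rfl

/-- The easy direction of the minimax principle: a random input that is bad for each fixed matrix is
bad for every random matrix. -/
theorem min_betaMeasure_le_deltaBest {m n : ℕ} (hn : 1 ≤ n) (hnm : n < m)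
    {t ε : ℝ} (ht : 0 < t) :
    min (betaMeasure (n / 2) ((m - n) / 2) (Set.Ioi ((1 + ε) * t)))
        (betaMeasure (n / 2) ((m - n) / 2) (Set.Iio ((1 - ε) * t))) ≤ deltaBest m n ε := by
  refine le_iInf fun P => ?_
  set γ := gaussWeight (EuclideanSpace ℝ (Fin m))
  set P' : Measure (Matrix (Fin n) (Fin m) ℝ) := (P : Measure (Matrix (Fin n) (Fin m) ℝ))
  have hS := measurableSet_prod_distortionEvent m n ε
  rw [← ENNReal.mul_le_mul_iff_left (gaussWeight_univ_ne_zero (E := EuclideanSpace ℝ (Fin m)))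
    (measure_ne_top γ _)]
  calc _ = ∫⁻ A, min (betaMeasure (n / 2) ((m - n) / 2) (Set.Ioi ((1 + ε) * t)))
        (betaMeasure (n / 2) ((m - n) / 2) (Set.Iio ((1 - ε) * t))) * γ Set.univ ∂P' := by
        rw [lintegral_const, measure_univ (μ := P'), mul_one]
    _ ≤ ∫⁻ A, γ {x | A ∈ distortionEvent m n ε x} ∂P' :=
        lintegral_mono fun A => min_betaMeasure_mul_le_gaussWeight_distortion hn hnm ht A
    _ = (P'.prod γ) {p | p.1 ∈ distortionEvent m n ε p.2} := (Measure.prod_apply hS).symm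
    _ = ∫⁻ x, P' (distortionEvent m n ε x) ∂γ := Measure.prod_apply_symm hS
    _ ≤ ∫⁻ _, (⨆ x, P' (distortionEvent m n ε x)) ∂γ :=
        lintegral_mono fun x => le_iSup (fun x => P' (distortionEvent m n ε x)) x
    _ = _ := by rw [lintegral_const]

/-! ### Upper bound: Haar-random rotations. -/

/-- Compactness lets Haar measure be normalised to a probability measure on the whole group. -/
instance compactSpace_unitaryGroup (m : ℕ) : CompactSpace (Matrix.unitaryGroup (Fin m) ℝ) := by
  have h : IsCompact (Set.univ.pi fun _ : Fin m => Set.univ.pi fun _ : Fin m =>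
      Set.Icc (-1 : ℝ) 1) :=
    isCompact_univ_pi fun _ => isCompact_univ_pi fun _ => isCompact_Icc
  refine isCompact_iff_compactSpace.1 (IsCompact.of_isClosed_subset h
    (isClosed_unitary (R := Matrix (Fin m) (Fin m) ℝ)) ?_)
  intro U hU i _ j _
  exact abs_le.1 (entry_norm_bound_of_unitary hU i j)

/-- The real unitary, that is orthogonal, group acting on Euclidean space by linear isometries. -/
noncomputable def unitaryGroupEquiv (m : ℕ) : Matrix.unitaryGroup (Fin m) ℝ ≃*
    (EuclideanSpace ℝ (Fin m) ≃ₗᵢ[ℝ] EuclideanSpace ℝ (Fin m)) :=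
  (Unitary.mapEquiv
    { Matrix.toEuclideanCLM (n := Fin m) (𝕜 := ℝ) with }).toMulEquiv.trans
    Unitary.linearIsometryEquiv

theorem unitaryGroupEquiv_apply {m : ℕ} (U : Matrix.unitaryGroup (Fin m) ℝ)
    (x : EuclideanSpace ℝ (Fin m)) :
    unitaryGroupEquiv m U x = Matrix.toEuclideanLin U.1 x := rfl

/-- Transitivity on spheres, by reflection in the hyperplane orthogonal to x - y. -/
theorem exists_unitaryGroupEquiv_apply_eq {m : ℕ} {x y : EuclideanSpace ℝ (Fin m)}
    (h : ‖x‖ = ‖y‖) : ∃ V, unitaryGroupEquiv m V x = y :=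
  ⟨(unitaryGroupEquiv m).symm (Submodule.reflection (Submodule.span ℝ {x - y})ᗮ), by
    rw [MulEquiv.apply_symm_apply, Submodule.reflection_sub h]⟩

theorem mul_mem_distortionEvent {m n : ℕ} {ε : ℝ} (T : Matrix (Fin n) (Fin m) ℝ)
    (U : Matrix.unitaryGroup (Fin m) ℝ) (x : EuclideanSpace ℝ (Fin m)) :
    T * U.1 ∈ distortionEvent m n ε x ↔
      T ∈ distortionEvent m n ε (unitaryGroupEquiv m U x) := by
  have h : Matrix.toEuclideanLin (T * U.1) x =
      Matrix.toEuclideanLin T (unitaryGroupEquiv m U x) := by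
    rw [unitaryGroupEquiv_apply]
    simp [Matrix.toLpLin_apply, Matrix.mulVec_mulVec]
  simp only [distortionEvent, Set.mem_ofPred_eq, h, LinearIsometryEquiv.norm_map]

theorem distortionEvent_smul {m n : ℕ} {ε c : ℝ} (hc : c ≠ 0) (x : EuclideanSpace ℝ (Fin m)) :
    distortionEvent m n ε (c • x) = distortionEvent m n ε x := by
  ext A
  have h : 0 < c ^ 2 := by positivity
  simp only [distortionEvent, Set.mem_ofPred_eq, map_smul, norm_smul, mul_pow, Real.norm_eq_abs,
    sq_abs, ← mul_sub, abs_mul, abs_of_pos h, gt_iff_lt]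
  rw [mul_left_comm, mul_lt_mul_iff_right₀ h]

theorem gaussWeight_distortion_mul {m n : ℕ} (ε : ℝ) (T : Matrix (Fin n) (Fin m) ℝ)
    (U : Matrix.unitaryGroup (Fin m) ℝ) :
    gaussWeight (EuclideanSpace ℝ (Fin m)) {x | T * U.1 ∈ distortionEvent m n ε x} =
      gaussWeight (EuclideanSpace ℝ (Fin m)) {x | T ∈ distortionEvent m n ε x} := by
  rw [← (unitaryGroupEquiv m U).measurePreserving_gaussWeight.measure_preimage
    (measurableSet_distortion_input ε T).nullMeasurableSet]
  exact congrArg _ (Set.ext fun x => mul_mem_distortionEvent T U x)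

/-- A probability measure on matrices under which all nonzero inputs have the same distortion
probability, equal to the Gaussian average of the distortion of one given matrix. -/
theorem exists_probabilityMeasure_distortion_le {m n : ℕ} [NeZero m] (ε : ℝ)
    (T : Matrix (Fin n) (Fin m) ℝ) :
    ∃ P : ProbabilityMeasure (Matrix (Fin n) (Fin m) ℝ), ∀ x,
      (P : Measure (Matrix (Fin n) (Fin m) ℝ)) (distortionEvent m n ε x) *
        gaussWeight (EuclideanSpace ℝ (Fin m)) Set.univ ≤
      gaussWeight (EuclideanSpace ℝ (Fin m)) {x | T ∈ distortionEvent m n ε x} := by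
  let : MeasurableSpace (Matrix.unitaryGroup (Fin m) ℝ) := borel _
  have : BorelSpace (Matrix.unitaryGroup (Fin m) ℝ) := ⟨rfl⟩
  have : SecondCountableTopology (Matrix (Fin m) (Fin m) ℝ) :=
    inferInstanceAs (SecondCountableTopology (Fin m → Fin m → ℝ))
  let h : Measure (Matrix.unitaryGroup (Fin m) ℝ) := Measure.haarMeasure ⊤
  have hprob : IsProbabilityMeasure h := ⟨Measure.haarMeasure_self⟩
  set γ := gaussWeight (EuclideanSpace ℝ (Fin m))
  -- The inverse matches left invariance of Haar measure: replacing y by Vy amounts to translating U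
  -- on the left by V⁻¹.
  have hf : Measurable fun U : Matrix.unitaryGroup (Fin m) ℝ => T * (U⁻¹).1 :=
    (continuous_const.matrix_mul (continuous_subtype_val.comp continuous_inv)).measurable
  have hS : MeasurableSet {p : Matrix.unitaryGroup (Fin m) ℝ × EuclideanSpace ℝ (Fin m) |
      T * (p.1⁻¹).1 ∈ distortionEvent m n ε p.2} :=
    (hf.prodMap measurable_id) (measurableSet_prod_distortionEvent m n ε)
  refine ⟨⟨h.map fun U => T * (U⁻¹).1, Measure.isProbabilityMeasure_map hf.aemeasurable⟩,
    fun x => ?_⟩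
  rw [ProbabilityMeasure.coe_mk, Measure.map_apply hf (measurableSet_distortionEvent m n ε x)]
  -- The origin is not reached from other inputs by rotation and scaling, but the strict inequality
  -- makes its distortion event empty.
  rcases eq_or_ne x 0 with rfl | hx
  · have : distortionEvent m n ε 0 = ∅ := by ext A; simp [distortionEvent]
    simp [this]
  let q : EuclideanSpace ℝ (Fin m) → ℝ≥0∞ :=
    fun y => h {U | T * (U⁻¹).1 ∈ distortionEvent m n ε y}
  have hrot : ∀ V y, q (unitaryGroupEquiv m V y) = q y := by
    intro V y
    change _ = h {U | T * (U⁻¹).1 ∈ distortionEvent m n ε y}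
    rw [← measure_preimage_mul h V⁻¹ {U | T * (U⁻¹).1 ∈ distortionEvent m n ε y}]
    refine congrArg h (Set.ext fun U => ?_)
    simp only [Set.mem_preimage, Set.mem_ofPred_eq, mul_mem_distortionEvent, mul_inv_rev, inv_inv,
      map_mul]
    rfl
  have hconst : ∀ y, y ≠ 0 → q x = q y := by
    intro y hy
    have hx' := norm_ne_zero_iff.2 hx
    have hy' := norm_ne_zero_iff.2 hy
    obtain ⟨V, hV⟩ := exists_unitaryGroupEquiv_apply_eq (x := (‖y‖ / ‖x‖) • x) (y := y)
      (by rw [norm_smul, norm_div, norm_norm, norm_norm, div_mul_cancel₀ _ hx'])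
    rw [← hV, hrot]
    simp only [q, distortionEvent_smul (div_ne_zero hy' hx')]
  have hne : ∀ᵐ y ∂γ, y ≠ 0 := by
    rw [ae_iff]
    simpa using gaussWeight_singleton (0 : EuclideanSpace ℝ (Fin m))
  refine Eq.le ?_
  change q x * γ Set.univ = γ {y | T ∈ distortionEvent m n ε y}
  calc q x * γ Set.univ = ∫⁻ _, q x ∂γ := (lintegral_const _).symm
    _ = ∫⁻ y, q y ∂γ := lintegral_congr_ae (hne.mono hconst)
    _ = (h.prod γ) {p | T * (p.1⁻¹).1 ∈ distortionEvent m n ε p.2} :=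
        (Measure.prod_apply_symm hS).symm
    _ = ∫⁻ U, γ {y | T * (U⁻¹).1 ∈ distortionEvent m n ε y} ∂h := Measure.prod_apply hS
    _ = ∫⁻ _, γ {y | T ∈ distortionEvent m n ε y} ∂h := by
        exact lintegral_congr fun U => gaussWeight_distortion_mul ε T U⁻¹
    _ = γ {y | T ∈ distortionEvent m n ε y} := by
        rw [lintegral_const, measure_univ, mul_one]

theorem deltaBest_le_betaMeasure_add {m n : ℕ} (hn : 1 ≤ n) (hnm : n < m)
    {t ε : ℝ} (ht : 0 < t) :
    deltaBest m n ε ≤ betaMeasure (n / 2) ((m - n) / 2) (Set.Ioi ((1 + ε) * t)) +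
        betaMeasure (n / 2) ((m - n) / 2) (Set.Iio ((1 - ε) * t)) := by
  have : NeZero n := ⟨by omega⟩
  have : NeZero m := ⟨by omega⟩
  have : NeZero (m - n) := ⟨by omega⟩
  -- Any isometric splitting of dimensions n and m - n serves here, so the zero map is used and the
  -- kernel property dropped.
  obtain ⟨φ, -⟩ := exists_linearIsometryEquiv_apply_snd_eq_zero hnm.le
    (finrank_euclideanSpace_fin (𝕜 := ℝ) (n := n)) 0
  let L : EuclideanSpace ℝ (Fin m) →ₗ[ℝ] EuclideanSpace ℝ (Fin n) :=
    -- With this scaling ‖Lx‖²/‖x‖² is t⁻¹ times the Beta ratio, so it has mean one when t is the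
    -- mean of that ratio.
    √t⁻¹ • (LinearMap.fst ℝ _ _ ∘ₗ (WithLp.linearEquiv 2 ℝ _).toLinearMap ∘ₗ
      φ.symm.toLinearEquiv.toLinearMap)
  obtain ⟨P, hP⟩ := exists_probabilityMeasure_distortion_le ε (Matrix.toEuclideanLin.symm L)
  refine (iInf_le _ P).trans (iSup_le fun x => ?_)
  rw [← ENNReal.mul_le_mul_iff_left (gaussWeight_univ_ne_zero (E := EuclideanSpace ℝ (Fin m)))
    (measure_ne_top _ _)]
  refine (hP x).trans ?_
  have hψ := φ.measurePreserving_gaussWeight.comp measurePreserving_toLp_gaussWeight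
  rw [← hψ.measure_preimage (measurableSet_distortion_input ε _).nullMeasurableSet,
    ← hψ.measure_preimage MeasurableSet.univ.nullMeasurableSet, Set.preimage_univ]
  have key := gaussWeight_prod_le_betaMeasure_mul
    (E := EuclideanSpace ℝ (Fin n)) (F := EuclideanSpace ℝ (Fin (m - n))) (ε := ε) ht
  rw [finrank_div_two_cast_sub hnm.le, finrank_euclideanSpace_fin] at key
  refine Eq.trans_le ?_ key
  congr 1
  ext p
  have h1 : ‖L (φ (WithLp.toLp 2 p))‖ ^ 2 = t⁻¹ * ‖p.1‖ ^ 2 := by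
    have : L (φ (WithLp.toLp 2 p)) = √t⁻¹ • p.1 := by simp [L]
    rw [this, norm_smul, mul_pow, Real.norm_eq_abs, sq_abs, Real.sq_sqrt (by positivity)]
  have h2 : ‖φ (WithLp.toLp 2 p)‖ ^ 2 = ‖p.1‖ ^ 2 + ‖p.2‖ ^ 2 := by
    rw [φ.norm_map, WithLp.prod_norm_sq_eq_of_L2]
    rfl
  simp only [distortionEvent, Set.mem_ofPred_eq, Set.mem_preimage, Function.comp_apply,
    LinearEquiv.apply_symm_apply, h1, h2, gt_iff_lt]

theorem mainTheorem5 (m n : ℕ) (hn : 1 ≤ n) (hnm : n < m) (ε : ℝ) (hε : 0 < ε) (hε' : ε < 1 / 2)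
    {Ω : Type*} [MeasurableSpace Ω] (μ : Measure Ω) (B : Ω → ℝ)
    (hB : HasLaw B (betaMeasure ((n : ℝ) / 2) (((m : ℝ) - (n : ℝ)) / 2)) μ) :
    min (μ {ω | B ω > (1 + ε) * ∫ ω', B ω' ∂μ}) (μ {ω | B ω < (1 - ε) * ∫ ω', B ω' ∂μ})
        ≤ deltaBest m n ε ∧
      deltaBest m n ε
        ≤ μ {ω | B ω > (1 + ε) * ∫ ω', B ω' ∂μ} + μ {ω | B ω < (1 - ε) * ∫ ω', B ω' ∂μ} := by
  have hn' : (0 : ℝ) < n := by exact_mod_cast hn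
  have hnm' : (n : ℝ) < m := by exact_mod_cast hnm
  have hE : ∫ ω', B ω' ∂μ = n / m := by
    rw [hB.integral_eq, integral_id_betaMeasure (by positivity) (by linarith)]
    field_simp
    ring
  have ht : (0 : ℝ) < n / m := div_pos hn' (hn'.trans hnm')
  rw [hE, hB.measure_eq (p := fun b => b > (1 + ε) * (n / m)) measurableSet_Ioi,
    hB.measure_eq (p := fun b => b < (1 - ε) * (n / m)) measurableSet_Iio]
  exact ⟨min_betaMeasure_le_deltaBest hn hnm ht, deltaBest_le_betaMeasure_add hn hnm ht⟩
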